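/- Let $M\ge 1$ and $N\ge 2$ be integers and let $A=(a_{kj})_{0\le k\le M-1,\,0\le j\le N-1}$ be a complex $M\times N$ matrix such that $\frac1N A^*A=I_N$ (that is, $\frac{1}{\sqrt N}A$ is an isometry) and whose first row is constantly $1$, i.e. $a_{0,j}=1$ for $j=0,\dots,N-1$. For $k\in\{0,\dots,M-1\}$ define $$m_k(x)=\sum_{j=0}^{N-1}a_{kj}\,\chi_{[j/N,(j+1)/N)}(x),\qquad V_k:L^2[0,1]\to L^2[0,1],\quad V_kf(x)=m_k(x)\,f(Nx \bmod 1),$$ where $L^2[0,1]$ is the complex $L^2$ space of Lebesgue measure. For a finite word $\omega=\omega_1\cdots\omega_n$ with letters in $\{0,\dots,M-1\}$ put $V_\omega=V_{\omega_1}\cdots V_{\omega_n}$, with $V_\omega=I$ for the empty word, and let $\mathbf 1$ be the constant function $1$. Then the family $\{V_\omega\mathbf 1\}$, indexed by all finite words $\omega$ (including the empty word) whose last letter is not $0$, is a Parseval frame for $L^2[0,1]$: for every $f\in L^2[0,1]$, $$\|f\|^2=\sum_{\omega\text{ not ending in }0}|\langle f,V_\omega\mathbf 1\rangle|^2 .$$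 -/

import Mathlib

open MeasureTheory

noncomputable section

namespace WalshFrame

/-- A family of vectors `e i` in a Hilbert space is a Parseval frame if
`‖v‖² = ∑ i, |⟨v, e i⟩|²` for every vector `v`. -/
def IsParsevalFrame {ι H : Type*} [NormedAddCommGroup H] [InnerProductSpace ℂ H]
    (e : ι → H) : Prop :=
  ∀ v : H, HasSum (fun i => ‖inner ℂ (e i) v‖ ^ 2) (‖v‖ ^ 2)

/-- Lebesgue measure on `[0, 1]`. -/
abbrev μI : Measure ℝ := volume.restrict (Set.Icc (0 : ℝ) 1)

/-- The Hilbert space `L²[0, 1]`, with complex scalars. -/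
abbrev L2I : Type := Lp ℂ 2 μI

/-- The map `x ↦ N x mod 1`. -/
def shiftMap (N : ℕ) (x : ℝ) : ℝ := Int.fract ((N : ℝ) * x)

/-- The map `x ↦ N x mod 1` preserves Lebesgue measure on `[0, 1]`. -/
theorem measurePreserving_shiftMap (N : ℕ) [NeZero N] :
    MeasurePreserving (shiftMap N) μI μI := by
  have hI : μI = volume.restrict (Set.Ioc (0 : ℝ) (0 + 1)) := by
    rw [zero_add]; exact (restrict_Ioc_eq_restrict_Icc).symm
  have hmk : MeasurePreserving (fun x : ℝ => (x : UnitAddCircle)) μI volume := by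
    rw [hI]; exact UnitAddCircle.measurePreserving_mk 0
  have hpow : MeasurePreserving (fun y : UnitAddCircle => (N : ℤ) • y) volume volume :=
    MeasureTheory.Measure.measurePreserving_zsmul volume (by exact_mod_cast NeZero.ne N)
  let s : UnitAddCircle → ℝ := fun y => (AddCircle.measurableEquivIco 1 0 y : ℝ)
  have hsm : Measurable s :=
    measurable_subtype_coe.comp (AddCircle.measurableEquivIco 1 0).measurable
  have hs : ∀ x : ℝ, s (x : UnitAddCircle) = Int.fract x := by
    intro x
    have := AddCircle.coe_equivIco_mk_apply (1 : ℝ) x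
    rw [div_one, mul_one] at this
    exact this
  have hsec : MeasurePreserving s volume μI := by
    refine ⟨hsm, ?_⟩
    rw [← hmk.map_eq, Measure.map_map hsm hmk.measurable]
    have : (s ∘ fun x : ℝ => (x : UnitAddCircle)) =ᵐ[μI] id := by
      have hI' : μI = volume.restrict (Set.Ico (0 : ℝ) 1) :=
        (restrict_Ico_eq_restrict_Icc).symm
      rw [hI']
      filter_upwards [ae_restrict_mem measurableSet_Ico] with x hx
      simp only [Function.comp_apply, hs, id]
      exact Int.fract_eq_self.2 ⟨hx.1, hx.2⟩
    rw [Measure.map_congr this, Measure.map_id]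
  have h := (hsec.comp hpow).comp hmk
  have heq : (s ∘ fun y : UnitAddCircle => (N : ℤ) • y) ∘ (fun x : ℝ => (x : UnitAddCircle))
      = shiftMap N := by
    funext x
    have : ((N : ℤ) • (x : UnitAddCircle)) = (((N : ℝ) * x : ℝ) : UnitAddCircle) := by
      rw [← AddCircle.coe_zsmul]; simp
    simp only [Function.comp_apply, this, hs, shiftMap]
  rwa [heq] at h

variable {M N : ℕ}

/-- The step function `m_k = ∑ j, a_{kj} χ_[j/N, (j+1)/N)`. -/
def stepFun (A : Matrix (Fin M) (Fin N) ℂ) (k : Fin M) (x : ℝ) : ℂ :=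
  ∑ j : Fin N,
    (Set.Ico ((j : ℝ) / N) (((j : ℝ) + 1) / N)).indicator (fun _ => A k j) x

/-- The step function `m_k` is essentially bounded. -/
theorem memLp_stepFun (A : Matrix (Fin M) (Fin N) ℂ) (k : Fin M) :
    MemLp (stepFun A k) ⊤ μI :=
  memLp_finsetSum _ fun j _ => (memLp_const (A k j)).indicator measurableSet_Ico

/-- The bounded operator `V_k` on `L²[0, 1]`, `V_k f (x) = m_k(x) f(N x mod 1)`: composition with
`x ↦ N x mod 1` followed by multiplication by `m_k`; see `walshOp_coeFn`. -/
def walshOp [NeZero N] (A : Matrix (Fin M) (Fin N) ℂ) (k : Fin M) : L2I →L[ℂ] L2I :=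
  ((ContinuousLinearMap.mul ℂ ℂ).holderL μI ⊤ 2 2 ((memLp_stepFun A k).toLp _)) ∘L
    (Lp.compMeasurePreservingₗᵢ ℂ (shiftMap N)
      (measurePreserving_shiftMap N)).toContinuousLinearMap

/-- The defining formula of `V_k`. -/
theorem walshOp_coeFn [NeZero N] (A : Matrix (Fin M) (Fin N) ℂ) (k : Fin M) (f : L2I) :
    walshOp A k f =ᵐ[μI] fun x => stepFun A k x * f (shiftMap N x) := by
  have h1 := (ContinuousLinearMap.mul ℂ ℂ).coeFn_holder (r := 2)
    ((memLp_stepFun A k).toLp _) (Lp.compMeasurePreserving (shiftMap N)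
      (measurePreserving_shiftMap N) f)
  filter_upwards [h1, (memLp_stepFun A k).coeFn_toLp,
    Lp.coeFn_compMeasurePreserving f (measurePreserving_shiftMap N)] with x h1 h2 h3
  refine h1.trans ?_
  rw [h2, h3]
  rfl

/-- For a word `ω = ω₁ ⋯ ωₙ` the operator `V_ω = V_{ω₁} ⋯ V_{ωₙ}`; for the empty word it is the
identity. -/
def wordOp [NeZero N] (A : Matrix (Fin M) (Fin N) ℂ) (ω : List (Fin M)) : L2I →L[ℂ] L2I :=
  (ω.map (walshOp A)).prod

/-- The constant function `1` in `L²[0, 1]`. -/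
def oneL2 : L2I := Lp.const 2 μI (1 : ℂ)

/-- The finite words over `{0, …, M - 1}`, the empty word included, whose last letter is
not `0`. -/
abbrev WordsNotEndingInZero (M : ℕ) [NeZero M] : Type :=
  {ω : List (Fin M) // ω.getLast? ≠ some 0}

end WalshFrame

end

open Filter Topology

noncomputable section

namespace WalshFrame

variable {M N : ℕ}

/-! ### The inverse branches of `x ↦ N x mod 1` -/

/-! Let `S_j f` be the pullback of `f` along the branch `x ↦ (x + j) / N`. The branches tile the
unit interval, so `N ‖f‖² = ∑ ‖S_j f‖²` and `N ⟨V_k g, f⟩ = ∑ conj(a_kj) ⟨g, S_j f⟩`. Let `E_n(f)`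
be the energy `f` has on words of length at most `n` not ending in `0`. Since `A*A = N I` and `V_0 1
= 1`, the same recursion holds for the energy: `N E_{n+1}(f) = ∑ E_n(S_j f)` (`frameEnergy_succ`).

Induction along the two recursions gives `E_n(f) ≤ ‖f‖²` and bounds the defect `‖f‖² - E_n(f)` by
`ε²` when `f` oscillates by at most `ε` at scale `N⁻ⁿ`. Uniform continuity and density of continuous
functions then give `E_n(f) → ‖f‖²`. -/

/-- The inverse branch `x ↦ (x + j) / N` of the map `x ↦ N x mod 1`. -/
def branch (N : ℕ) (j : Fin N) (x : ℝ) : ℝ := (x + j) / N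

theorem measurable_branch (j : Fin N) : Measurable (branch N j) :=
  (measurable_id.add_const _).div_const _

theorem μI_eq_restrict_Ico : μI = volume.restrict (Set.Ico (0 : ℝ) 1) :=
  restrict_Ico_eq_restrict_Icc.symm

theorem branch_mem_Ico_iff [NeZero N] (j : Fin N) (l : ℕ) (x : ℝ) :
    branch N j x ∈ Set.Ico ((l : ℝ) / N) (((l : ℝ) + 1) / N) ↔
      x + j ∈ Set.Ico (l : ℝ) (l + 1) := by
  have hN : (0 : ℝ) < N := by exact_mod_cast NeZero.pos N
  simp only [branch, Set.mem_Ico, div_le_div_iff_of_pos_right hN, div_lt_div_iff_of_pos_right hN]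

theorem branch_mem_Ico_iff_eq [NeZero N] (j l : Fin N) {x : ℝ} (hx : x ∈ Set.Ico (0 : ℝ) 1) :
    branch N j x ∈ Set.Ico ((l : ℝ) / N) (((l : ℝ) + 1) / N) ↔ l = j := by
  rw [branch_mem_Ico_iff]
  constructor
  · rintro ⟨h1, h2⟩
    have a : (l : ℝ) < j + 1 := by linarith [hx.2]
    have b : (j : ℝ) < l + 1 := by linarith [hx.1]
    have a' : (l : ℕ) < j + 1 := by exact_mod_cast a
    have b' : (j : ℕ) < l + 1 := by exact_mod_cast b
    exact Fin.ext (by omega)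
  · rintro rfl
    exact ⟨by linarith [hx.1], by linarith [hx.2]⟩

theorem branch_mem_Icc [NeZero N] (j : Fin N) {x : ℝ} (hx : x ∈ Set.Icc (0 : ℝ) 1) :
    branch N j x ∈ Set.Icc (0 : ℝ) 1 := by
  have hN : (0 : ℝ) < N := by exact_mod_cast NeZero.pos N
  have hj : (j : ℝ) + 1 ≤ N := by exact_mod_cast j.2
  refine ⟨div_nonneg (add_nonneg hx.1 (Nat.cast_nonneg _)) hN.le, ?_⟩
  rw [branch, div_le_one hN]
  linarith [hx.2]

theorem shiftMap_branch [NeZero N] (j : Fin N) {x : ℝ} (hx : x ∈ Set.Ico (0 : ℝ) 1) :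
    shiftMap N (branch N j x) = x := by
  have hN : (N : ℝ) ≠ 0 := by exact_mod_cast NeZero.ne N
  rw [shiftMap, branch, mul_div_cancel₀ _ hN, Int.fract_add_natCast, Int.fract_eq_self.2 hx]

theorem stepFun_branch [NeZero N] (A : Matrix (Fin M) (Fin N) ℂ) (k : Fin M) (j : Fin N)
    {x : ℝ} (hx : x ∈ Set.Ico (0 : ℝ) 1) : stepFun A k (branch N j x) = A k j := by
  classical
  simp [stepFun, Set.indicator_apply, branch_mem_Ico_iff_eq j _ hx]

theorem map_branch [NeZero N] (j : Fin N) :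
    Measure.map (branch N j) μI =
      (N : ENNReal) • volume.restrict (Set.Ico ((j : ℝ) / N) (((j : ℝ) + 1) / N)) := by
  have hN : (N : ℝ) ≠ 0 := by exact_mod_cast NeZero.ne N
  have hvol : Measure.map (branch N j) volume = (N : ENNReal) • volume := by
    have h1 : branch N j = (fun x : ℝ => (N : ℝ)⁻¹ * x) ∘ fun x : ℝ => x + j := by
      funext x; simp [branch, div_eq_inv_mul]
    rw [h1, ← Measure.map_map (measurable_const_mul _) (measurable_add_const _),
      (measurePreserving_add_right volume (j : ℝ)).map_eq,
      Real.map_volume_mul_left (inv_ne_zero hN)]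
    simp
  have hpre : branch N j ⁻¹' Set.Ico ((j : ℝ) / N) (((j : ℝ) + 1) / N) = Set.Ico 0 1 := by
    ext x
    rw [Set.mem_preimage, branch_mem_Ico_iff]
    simp only [Set.mem_Ico, le_add_iff_nonneg_left, add_comm (j : ℝ) 1, add_lt_add_iff_right]
  rw [μI_eq_restrict_Ico, ← hpre, ← Measure.restrict_map (measurable_branch j) measurableSet_Ico,
    hvol, Measure.restrict_smul]

theorem iUnion_Ico_div [NeZero N] :
    ⋃ j : Fin N, Set.Ico ((j : ℝ) / N) (((j : ℝ) + 1) / N) = Set.Ico 0 1 := by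
  have hN : (0 : ℝ) < N := by exact_mod_cast NeZero.pos N
  ext x
  simp only [Set.mem_iUnion, Set.mem_Ico, div_le_iff₀ hN, lt_div_iff₀ hN]
  constructor
  · rintro ⟨j, h1, h2⟩
    have hj : (j : ℝ) + 1 ≤ N := by exact_mod_cast j.2
    have hj0 : (0 : ℝ) ≤ j := Nat.cast_nonneg _
    constructor <;> nlinarith
  · rintro ⟨h0, h1⟩
    have hx : 0 ≤ x * N := mul_nonneg h0 hN.le
    refine ⟨⟨⌊x * N⌋₊, (Nat.floor_lt hx).2 (by nlinarith)⟩, Nat.floor_le hx,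
      Nat.lt_floor_add_one _⟩

theorem pairwise_disjoint_Ico_div [NeZero N] :
    Pairwise (Function.onFun Disjoint
      fun j : Fin N => Set.Ico ((j : ℝ) / N) (((j : ℝ) + 1) / N)) := by
  have hN : (0 : ℝ) < N := by exact_mod_cast NeZero.pos N
  intro i j hij
  refine Set.disjoint_left.2 fun x hi hj => hij (Fin.ext ?_)
  simp only [Set.mem_Ico, div_le_iff₀ hN, lt_div_iff₀ hN] at hi hj
  have a : (i : ℝ) < j + 1 := by linarith
  have b : (j : ℝ) < i + 1 := by linarith
  have a' : (i : ℕ) < j + 1 := by exact_mod_cast a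
  have b' : (j : ℕ) < i + 1 := by exact_mod_cast b
  omega

/-- Each branch pushes Lebesgue measure to `N` times its restriction to one cell, and the cells
partition `[0, 1)`. -/
theorem sum_map_branch [NeZero N] :
    ∑ j : Fin N, Measure.map (branch N j) μI = (N : ENNReal) • μI := by
  simp_rw [map_branch]
  rw [← Finset.smul_sum, μI_eq_restrict_Ico, ← iUnion_Ico_div (N := N),
    Measure.restrict_iUnion pairwise_disjoint_Ico_div fun _ => measurableSet_Ico,
    Measure.sum_fintype]

theorem map_branch_le [NeZero N] (j : Fin N) :
    Measure.map (branch N j) μI ≤ (N : ENNReal) • μI := by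
  rw [← sum_map_branch]
  exact Finset.single_le_sum (f := fun j : Fin N => Measure.map (branch N j) μI)
    (fun _ _ => Measure.zero_le _) (Finset.mem_univ j)

theorem quasiMeasurePreserving_branch [NeZero N] (j : Fin N) :
    Measure.QuasiMeasurePreserving (branch N j) μI μI :=
  ⟨measurable_branch j,
    (Measure.absolutelyContinuous_of_le (map_branch_le j)).trans Measure.smul_absolutelyContinuous⟩

theorem sum_integral_branch [NeZero N] {E : Type*} [NormedAddCommGroup E] [NormedSpace ℝ E]
    {F : ℝ → E} (hF : Integrable F μI) :
    ∑ j : Fin N, ∫ x, F (branch N j x) ∂μI = (N : ℝ) • ∫ x, F x ∂μI := by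
  have hF' : Integrable F ((N : ENNReal) • μI) := hF.smul_measure (ENNReal.natCast_ne_top N)
  have hj : ∀ j : Fin N, Integrable F (Measure.map (branch N j) μI) := fun j =>
    hF'.mono_measure (map_branch_le j)
  have h := integral_smul_measure F (μ := μI) (N : ENNReal)
  rw [← sum_map_branch, integral_finsetSum_measure fun j _ => hj j] at h
  simp only [ENNReal.toReal_natCast] at h
  rw [← h]
  exact Finset.sum_congr rfl fun j _ =>
    (integral_map (measurable_branch j).aemeasurable (hj j).aestronglyMeasurable).symm

/-- The pullback of an `L²` function under an inverse branch is `L²`. -/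
theorem memLp_comp_branch [NeZero N] (j : Fin N) (f : L2I) : MemLp (f ∘ branch N j) 2 μI :=
  ((Lp.memLp f).of_measure_le_smul (ENNReal.natCast_ne_top N) (map_branch_le j)).comp_of_map
    (measurable_branch j).aemeasurable

/-- Pullback of an `L²` function under the inverse branch `x ↦ (x + j) / N`. -/
def pullback [NeZero N] (j : Fin N) (f : L2I) : L2I := (memLp_comp_branch j f).toLp _

theorem pullback_coeFn [NeZero N] (j : Fin N) (f : L2I) :
    pullback j f =ᵐ[μI] fun x => f (branch N j x) :=
  (memLp_comp_branch j f).coeFn_toLp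

/-- Change of variables on each cell: along branch `j` the step function is the constant `A k j`,
and the shift undoes the branch. -/
theorem inner_walshOp [NeZero N] (A : Matrix (Fin M) (Fin N) ℂ) (k : Fin M) (g f : L2I) :
    (N : ℂ) * inner ℂ (walshOp A k g) f =
      ∑ j : Fin N, star (A k j) * inner ℂ g (pullback j f) := by
  have hae : (fun x => inner ℂ (walshOp A k g x) (f x)) =ᵐ[μI]
      fun x => inner ℂ (stepFun A k x * g (shiftMap N x)) (f x) := by
    filter_upwards [walshOp_coeFn A k g] with x hx
    rw [hx]
  have h := sum_integral_branch (N := N) ((L2.integrable_inner (𝕜 := ℂ) _ f).congr hae)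
  rw [← integral_congr_ae hae, ← L2.inner_def, Complex.real_smul, Complex.ofReal_natCast] at h
  rw [← h]
  refine Finset.sum_congr rfl fun j _ => ?_
  rw [L2.inner_def, ← integral_const_mul]
  refine integral_congr_ae ?_
  have hm : ∀ᵐ x ∂μI, x ∈ Set.Ico (0 : ℝ) 1 := by
    rw [μI_eq_restrict_Ico]; exact ae_restrict_mem measurableSet_Ico
  filter_upwards [hm, pullback_coeFn j f] with x hx hp
  rw [hp, stepFun_branch A k j hx, shiftMap_branch j hx]
  simp only [RCLike.inner_apply, map_mul, Complex.star_def]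
  ring

theorem sum_norm_pullback_sq [NeZero N] (f : L2I) :
    ∑ j : Fin N, ‖pullback j f‖ ^ 2 = N * ‖f‖ ^ 2 := by
  have hnorm : ∀ g : L2I, ((‖g‖ ^ 2 : ℝ) : ℂ) = ∫ x, inner ℂ (g x) (g x) ∂μI := fun g => by
    rw [← L2.inner_def, inner_self_eq_norm_sq_to_K]; simp
  have h := sum_integral_branch (N := N) (L2.integrable_inner (𝕜 := ℂ) f f)
  rw [← hnorm, Complex.real_smul] at h
  have h' : ((∑ j : Fin N, ‖pullback j f‖ ^ 2 : ℝ) : ℂ) = ((N * ‖f‖ ^ 2 : ℝ) : ℂ) := by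
    rw [Complex.ofReal_sum, Complex.ofReal_mul, ← h]
    refine Finset.sum_congr rfl fun j _ => ?_
    rw [hnorm]
    refine integral_congr_ae ?_
    filter_upwards [pullback_coeFn j f] with x hx
    rw [hx]
  exact_mod_cast h'

/-! ### Sums over finite sets of words -/

/-- The words of length at most `n` that do not end in `0`. -/
def shortWords (M : ℕ) [NeZero M] : ℕ → Finset (List (Fin M))
  | 0 => {[]}
  | n + 1 => insert [] (((Finset.univ ×ˢ shortWords M n).image fun p => p.1 :: p.2).erase [0])

theorem mem_shortWords [NeZero M] (n : ℕ) (ω : List (Fin M)) :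
    ω ∈ shortWords M n ↔ ω.getLast? ≠ some 0 ∧ ω.length ≤ n := by
  induction n generalizing ω with
  | zero => cases ω <;> simp [shortWords]
  | succ n ih =>
    cases ω with
    | nil => simp [shortWords]
    | cons k τ => cases τ <;> simp [shortWords, ih]

theorem wordOp_nil [NeZero N] (A : Matrix (Fin M) (Fin N) ℂ) (f : L2I) :
    wordOp A [] f = f := by
  simp [wordOp]

theorem wordOp_cons [NeZero N] (A : Matrix (Fin M) (Fin N) ℂ) (k : Fin M) (ω : List (Fin M))
    (f : L2I) : wordOp A (k :: ω) f = walshOp A k (wordOp A ω f) := by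
  simp [wordOp]

/-- The energy of `f` captured by the words of length at most `n` not ending in `0`. -/
def frameEnergy [NeZero M] [NeZero N] (A : Matrix (Fin M) (Fin N) ℂ) (n : ℕ) (f : L2I) : ℝ :=
  ∑ ω ∈ shortWords M n, ‖inner ℂ (wordOp A ω oneL2) f‖ ^ 2

theorem oneL2_coeFn : oneL2 =ᵐ[μI] fun _ => (1 : ℂ) := Lp.coeFn_const ..

theorem norm_oneL2 : ‖oneL2‖ = 1 := by
  have h := Lp.norm_const' (μ := μI) (c := (1 : ℂ)) (p := 2) (by simp) (by simp)
  refine h.trans ?_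
  simp

/-- This makes a trailing `0` redundant: it does not change the vector attached to a word. -/
theorem walshOp_zero_oneL2 [NeZero M] [NeZero N] (A : Matrix (Fin M) (Fin N) ℂ)
    (hrow : ∀ j : Fin N, A 0 j = 1) : walshOp A 0 oneL2 = oneL2 := by
  have hm : ∀ᵐ x ∂μI, x ∈ Set.Ico (0 : ℝ) 1 := by
    rw [μI_eq_restrict_Ico]; exact ae_restrict_mem measurableSet_Ico
  refine Lp.ext ?_
  filter_upwards [walshOp_coeFn A 0 oneL2, oneL2_coeFn,
    (measurePreserving_shiftMap N).quasiMeasurePreserving.ae oneL2_coeFn, hm] with x h1 h2 h3 hx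
  rw [h1, h2, h3, mul_one]
  rw [← iUnion_Ico_div (N := N)] at hx
  obtain ⟨j, hj⟩ := Set.mem_iUnion.1 hx
  rw [stepFun, Finset.sum_eq_single j, Set.indicator_of_mem hj, hrow]
  · intro l _ hl
    exact Set.indicator_of_notMem
      (Set.disjoint_left.1 (pairwise_disjoint_Ico_div hl.symm) hj) _
  · simp

theorem sum_norm_sq_isometry [NeZero N] (A : Matrix (Fin M) (Fin N) ℂ)
    (hA : (1 / (N : ℂ)) • (A.conjTranspose * A) = 1) (v : Fin N → ℂ) :
    ∑ k, ‖∑ j, star (A k j) * v j‖ ^ 2 = N * ∑ j, ‖v j‖ ^ 2 := by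
  have hN : (N : ℂ) ≠ 0 := by exact_mod_cast NeZero.ne N
  have hA' : A.conjTranspose * A = (N : ℂ) • (1 : Matrix (Fin N) (Fin N) ℂ) := by
    rw [← hA, smul_smul, mul_one_div_cancel hN, one_smul]
  have hsq : ∀ {ι : Type} [Fintype ι] (w : ι → ℂ),
      ((∑ i, ‖w i‖ ^ 2 : ℝ) : ℂ) = dotProduct (star w) w := fun w => by
    simp [dotProduct, Complex.conj_mul']
  -- The sums in the goal are the conjugates of the entries of `A (star v)`, hence the inner
  -- conjugation.
  have h : dotProduct (star (A.mulVec (star v))) (A.mulVec (star v)) =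
      N * dotProduct (star (star v)) (star v) := by
    rw [Matrix.star_mulVec, Matrix.dotProduct_mulVec, Matrix.vecMul_vecMul, hA',
      Matrix.vecMul_smul, Matrix.vecMul_one, smul_dotProduct, smul_eq_mul]
  rw [← hsq, ← hsq] at h
  have h' : ∑ k, ‖A.mulVec (star v) k‖ ^ 2 = N * ∑ j, ‖star v j‖ ^ 2 := by exact_mod_cast h
  simp only [Pi.star_apply, norm_star] at h'
  rw [← h']
  refine Finset.sum_congr rfl fun k _ => ?_
  rw [← norm_star]
  simp [Matrix.mulVec, dotProduct]

/-! ### Captured energy: recursion, upper bound and limit -/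

section Energy

variable [NeZero M] [NeZero N] {A : Matrix (Fin M) (Fin N) ℂ}

theorem frameEnergy_zero (f : L2I) : frameEnergy A 0 f = ‖inner ℂ oneL2 f‖ ^ 2 := by
  simp [frameEnergy, shortWords, wordOp_nil]

/-- Prepending a letter to the words of level `n` yields those of level `n + 1`, except that `[0]`
appears in place of `[]`; both give the vector `1`. -/
theorem frameEnergy_succ_eq_sum (hrow : ∀ j : Fin N, A 0 j = 1) (n : ℕ) (f : L2I) :
    frameEnergy A (n + 1) f =
      ∑ k, ∑ ω ∈ shortWords M n, ‖inner ℂ (wordOp A (k :: ω) oneL2) f‖ ^ 2 := by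
  have hnil : ([] : List (Fin M)) ∉
      ((Finset.univ ×ˢ shortWords M n).image fun p => p.1 :: p.2).erase [0] := by simp
  have hmem : ([0] : List (Fin M)) ∈ (Finset.univ ×ˢ shortWords M n).image fun p => p.1 :: p.2 := by
    simp [mem_shortWords]
  have h0 : wordOp A [0] oneL2 = wordOp A [] oneL2 := by
    rw [wordOp_cons, wordOp_nil, walshOp_zero_oneL2 A hrow]
  rw [frameEnergy, shortWords, Finset.sum_insert hnil, ← h0, Finset.add_sum_erase _
    (fun ω => ‖inner ℂ (wordOp A ω oneL2) f‖ ^ 2) hmem, Finset.sum_image, Finset.sum_product]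
  rintro ⟨a, b⟩ _ ⟨c, d⟩ _ h
  simpa using h

theorem frameEnergy_succ (hA : (1 / (N : ℂ)) • (A.conjTranspose * A) = 1)
    (hrow : ∀ j : Fin N, A 0 j = 1) (n : ℕ) (f : L2I) :
    N * frameEnergy A (n + 1) f = ∑ j : Fin N, frameEnergy A n (pullback j f) := by
  have hN : (N : ℝ) ≠ 0 := by exact_mod_cast NeZero.ne N
  rw [frameEnergy_succ_eq_sum hrow]
  simp only [frameEnergy]
  rw [Finset.sum_comm, Finset.sum_comm (s := Finset.univ), Finset.mul_sum]
  refine Finset.sum_congr rfl fun ω _ => mul_left_cancel₀ hN ?_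
  rw [← sum_norm_sq_isometry A hA, Finset.mul_sum, Finset.mul_sum]
  refine Finset.sum_congr rfl fun k _ => ?_
  rw [← inner_walshOp, wordOp_cons, norm_mul, Complex.norm_natCast]
  ring

theorem frameEnergy_nonneg (n : ℕ) (f : L2I) : 0 ≤ frameEnergy A n f :=
  Finset.sum_nonneg fun _ _ => sq_nonneg _

theorem frameEnergy_le (hA : (1 / (N : ℂ)) • (A.conjTranspose * A) = 1)
    (hrow : ∀ j : Fin N, A 0 j = 1) (n : ℕ) (f : L2I) : frameEnergy A n f ≤ ‖f‖ ^ 2 := by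
  have hN : (0 : ℝ) < N := by exact_mod_cast NeZero.pos N
  induction n generalizing f with
  | zero =>
    have h := norm_inner_le_norm (𝕜 := ℂ) oneL2 f
    rw [norm_oneL2, one_mul] at h
    rw [frameEnergy_zero]
    gcongr
  | succ n ih =>
    refine le_of_mul_le_mul_left ?_ hN
    rw [frameEnergy_succ hA hrow, ← sum_norm_pullback_sq]
    exact Finset.sum_le_sum fun j _ => ih _

theorem frameEnergy_add_add_sub (n : ℕ) (f g : L2I) :
    frameEnergy A n (f + g) + frameEnergy A n (f - g) =
      2 * (frameEnergy A n f + frameEnergy A n g) := by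
  simp only [frameEnergy, ← Finset.sum_add_distrib, Finset.mul_sum]
  refine Finset.sum_congr rfl fun ω _ => ?_
  rw [inner_add_right, inner_sub_right]
  exact parallelogram_law_with_norm ℂ _ _

/-- The energy of `f + g` not captured by the short words, in terms of that of `f` and `g`. -/
theorem norm_sq_sub_frameEnergy_add_le (hA : (1 / (N : ℂ)) • (A.conjTranspose * A) = 1)
    (hrow : ∀ j : Fin N, A 0 j = 1) (n : ℕ) (f g : L2I) :
    ‖f + g‖ ^ 2 - frameEnergy A n (f + g) ≤
      2 * (‖f‖ ^ 2 - frameEnergy A n f) + 2 * ‖g‖ ^ 2 := by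
  have h1 := frameEnergy_add_add_sub (A := A) n f g
  have h2 := parallelogram_law_with_norm ℂ f g
  have h3 := frameEnergy_le hA hrow n (f - g)
  have h4 := frameEnergy_nonneg (A := A) n g
  linarith

/-- The left side is the squared distance from `f` to the constants. -/
theorem norm_sq_sub_inner_oneL2_le (f : L2I) (c : ℂ) :
    ‖f‖ ^ 2 - ‖inner ℂ oneL2 f‖ ^ 2 ≤ ‖f - c • oneL2‖ ^ 2 := by
  have h := norm_sub_sq (𝕜 := ℂ) f (c • oneL2)
  have hre : RCLike.re (inner ℂ f (c • oneL2)) ≤ ‖c‖ * ‖inner ℂ oneL2 f‖ := by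
    refine (RCLike.re_le_norm _).trans ?_
    rw [inner_smul_right, norm_mul, norm_inner_symm]
  rw [norm_smul, norm_oneL2, mul_one] at h
  nlinarith [sq_nonneg (‖c‖ - ‖inner ℂ oneL2 f‖)]

/-- A function that varies by at most `ε` on intervals of length `N⁻ⁿ` has all but `ε²` of its
energy captured by the words of length at most `n`. -/
theorem norm_sq_sub_frameEnergy_le_of_oscillation
    (hA : (1 / (N : ℂ)) • (A.conjTranspose * A) = 1) (hrow : ∀ j : Fin N, A 0 j = 1)
    {ε : ℝ} (hε : 0 ≤ ε) (n : ℕ) (f : L2I) (g : ℝ → ℂ) (hfg : f =ᵐ[μI] g)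
    (hg : ∀ x ∈ Set.Icc (0 : ℝ) 1, ∀ y ∈ Set.Icc (0 : ℝ) 1, |x - y| * N ^ n ≤ 1 →
      ‖g x - g y‖ ≤ ε) :
    ‖f‖ ^ 2 - frameEnergy A n f ≤ ε ^ 2 := by
  have hN : (0 : ℝ) < N := by exact_mod_cast NeZero.pos N
  induction n generalizing f g with
  | zero =>
    rw [frameEnergy_zero]
    refine (norm_sq_sub_inner_oneL2_le f (g 0)).trans ?_
    have hb : ‖f - g 0 • oneL2‖ ≤ ε := by
      refine (Lp.norm_le_of_ae_bound (C := ε) hε ?_).trans ?_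
      · filter_upwards [Lp.coeFn_sub f (g 0 • oneL2), Lp.coeFn_smul (g 0) oneL2, oneL2_coeFn, hfg,
          ae_restrict_mem measurableSet_Icc] with x h1 h2 h3 h4 hx
        rw [h1, Pi.sub_apply, h2, Pi.smul_apply, h3, h4, smul_eq_mul, mul_one]
        refine hg x hx 0 ⟨le_rfl, zero_le_one⟩ ?_
        rw [sub_zero, abs_of_nonneg hx.1]
        simpa using hx.2
      · simp [measureUnivNNReal]
    gcongr
  | succ n ih =>
    refine le_of_mul_le_mul_left ?_ hN
    rw [mul_sub, frameEnergy_succ hA hrow, ← sum_norm_pullback_sq, ← Finset.sum_sub_distrib]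
    refine (Finset.sum_le_card_nsmul Finset.univ _ (ε ^ 2) fun j _ =>
      ih (pullback j f) (g ∘ branch N j) ?_ ?_).trans_eq (by simp)
    · exact (pullback_coeFn j f).trans ((quasiMeasurePreserving_branch j).ae hfg)
    · intro x hx y hy hxy
      refine hg _ (branch_mem_Icc j hx) _ (branch_mem_Icc j hy) ?_
      -- A branch contracts by `N`, which turns scale `N⁻ⁿ` for `g ∘ branch N j` into scale
      -- `N⁻⁽ⁿ⁺¹⁾` for `g`.
      have : branch N j x - branch N j y = (x - y) / N := by simp only [branch]; ring
      rw [this, abs_div, Nat.abs_cast, pow_succ]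
      field_simp
      exact hxy

theorem tendsto_frameEnergy (hN2 : 2 ≤ N) (hA : (1 / (N : ℂ)) • (A.conjTranspose * A) = 1)
    (hrow : ∀ j : Fin N, A 0 j = 1) (f : L2I) :
    Tendsto (fun n => frameEnergy A n f) atTop (𝓝 (‖f‖ ^ 2)) := by
  rw [Metric.tendsto_atTop]
  intro δ hδ
  -- The final defect is at most `2ε² + 2ε²`, from `G` and from `f - G`; as `ε ≤ 1`, this is at most
  -- `4ε < δ`.
  set ε : ℝ := min 1 (δ / 5) with hεdef
  have hε : 0 < ε := lt_min one_pos (by positivity)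
  have hεδ : 4 * ε ^ 2 < δ := by
    have h1 : ε ≤ 1 := min_le_left _ _
    have h2 : ε ≤ δ / 5 := min_le_right _ _
    nlinarith
  obtain ⟨g, hg⟩ := (BoundedContinuousFunction.toLp_denseRange ℂ μI ℂ (p := 2)
    (by simp)).exists_dist_lt f hε
  set G : L2I := BoundedContinuousFunction.toLp 2 μI ℂ g
  obtain ⟨η, hη, hosc⟩ := Metric.uniformContinuousOn_iff.1
    (isCompact_Icc.uniformContinuousOn_of_continuous g.continuous.continuousOn) ε hε
  obtain ⟨n₀, hn₀⟩ := pow_unbounded_of_one_lt (1 / η)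
    (show (1 : ℝ) < N by exact_mod_cast hN2)
  refine ⟨n₀, fun n hn => ?_⟩
  have hpow : 1 / η < (N : ℝ) ^ n :=
    hn₀.trans_le (pow_le_pow_right₀ (by exact_mod_cast (by omega : 1 ≤ N)) hn)
  have hG : ‖G‖ ^ 2 - frameEnergy A n G ≤ ε ^ 2 := by
    refine norm_sq_sub_frameEnergy_le_of_oscillation hA hrow hε.le n G g
      (BoundedContinuousFunction.coeFn_toLp 2 μI ℂ g) fun x hx y hy hxy => ?_
    rw [← dist_eq_norm]
    refine (hosc x hx y hy ?_).le
    rw [Real.dist_eq]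
    by_contra! h
    rw [div_lt_iff₀ hη] at hpow
    have : (N : ℝ) ^ n * η ≤ (N : ℝ) ^ n * |x - y| := by gcongr
    linarith
  have h := norm_sq_sub_frameEnergy_add_le hA hrow n G (f - G)
  rw [add_sub_cancel] at h
  have hsq : ‖f - G‖ ^ 2 ≤ ε ^ 2 := by
    rw [← dist_eq_norm]
    gcongr
  have hle := frameEnergy_le hA hrow n f
  rw [Real.dist_eq, abs_sub_comm, abs_of_nonneg (by linarith)]
  linarith

end Energy

end WalshFrame

end

theorem mainTheorem12 (M N : ℕ) [NeZero M] [NeZero N] (hN : 2 ≤ N)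
    (A : Matrix (Fin M) (Fin N) ℂ)
    (hA : (1 / (N : ℂ)) • (A.conjTranspose * A) = 1)
    (hrow : ∀ j : Fin N, A 0 j = 1) :
    WalshFrame.IsParsevalFrame
      (fun ω : WalshFrame.WordsNotEndingInZero M =>
        WalshFrame.wordOp A ω.1 WalshFrame.oneL2) := by
  intro f
  have hsum : ∀ n, ∑ ω ∈ (WalshFrame.shortWords M n).subtype fun ω => ω.getLast? ≠ some 0,
      ‖inner ℂ (WalshFrame.wordOp A ω.1 WalshFrame.oneL2) f‖ ^ 2 =
        WalshFrame.frameEnergy A n f := fun n =>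
    Finset.sum_subtype_of_mem
      (fun ω => ‖inner ℂ (WalshFrame.wordOp A ω WalshFrame.oneL2) f‖ ^ 2)
      fun ω hω => ((WalshFrame.mem_shortWords n ω).1 hω).1
  -- With nonnegative terms it suffices that `‖f‖²` is the supremum of the finite sums; any finite
  -- set of words lies in some `shortWords M n`.
  refine hasSum_of_isLUB_of_nonneg _ (fun _ => sq_nonneg _) ⟨?_, fun b hb => ?_⟩
  · rintro _ ⟨s, rfl⟩
    refine le_trans ?_ (WalshFrame.frameEnergy_le hA hrow (s.sup fun ω => ω.1.length) f)
    rw [← hsum]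
    refine Finset.sum_le_sum_of_subset_of_nonneg (fun ω hω => ?_) fun _ _ _ => sq_nonneg _
    exact Finset.mem_subtype.2 ((WalshFrame.mem_shortWords _ _).2
      ⟨ω.2, Finset.le_sup (f := fun ω : WalshFrame.WordsNotEndingInZero M => ω.1.length) hω⟩)
  · refine le_of_tendsto' (WalshFrame.tendsto_frameEnergy hN hA hrow f) fun n => ?_
    rw [← hsum]
    exact hb ⟨_, rfl⟩
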